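/- Let $K\ge 2$. Let $f:\mathbb R^K\to[0,\infty)$ be a probability density with respect to Lebesgue measure that is invariant under permutations of the coordinates. Let $\mathcal X_K$ be the set of pairs $(v,\Sigma)\in\mathbb R^K\times\mathbb R^{K\times K}$ with $\sum_k v_k=0$, $\Sigma$ symmetric positive semidefinite, $\Sigma\mathbf 1=0$ and $\operatorname{tr}\Sigma=K$. With $\Sigma^{1/2}$ the symmetric positive semidefinite square root, the choice probabilities are $$P_j(v,\Sigma)=\int_{\mathcal R_j(v,\Sigma)} f(e)\,de,\qquad \mathcal R_j(v,\Sigma)=\{e: v_j+(\Sigma^{1/2}e)_j\ge v_k+(\Sigma^{1/2}e)_k\ \text{for all } k\ne j\}.$$ Let $\mathcal B_j$ be the set of $(v,\Sigma)\in\mathcal X_K$ for which at least one of the following fails: (a) the triples $(v_k,\Sigma_{kk},\Sigma_{jk})$, $k\neq j$, are pairwise distinct, and the entries $\Sigma_{kl}$ with $k<l$, $k,l\ne j$, are pairwise distinct; (b) for each $k\ne j$ there is exactly one set $S$ of $K-2$ positions $(m,l)$ with $m<l$ and $m,l\neq j$ such that $\sum_{(m,l)\in S}\Sigma_{ml}=-\Sigma_{kk}-\Sigma_{jk}$.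 Let $\mathcal T_j$ be the set of $(v,\Sigma)$ at which $j$ ties with certainty with some other alternative, that is, $v_j=v_k$ and $\Sigma_{jj}+\Sigma_{kk}-2\Sigma_{jk}=0$ for some $k\ne j$. Fix an infinitely differentiable activation function $\sigma:\mathbb R\to\mathbb R$ that is not a polynomial. A multi-layer perceptron (MLP) is a composition of finitely many (possibly zero) hidden layers $x\mapsto\sigma(Wx+b)$, $\sigma$ acting entrywise, of arbitrary widths, followed by an affine output layer. A per-alternative encoder with output dimension $d$ consists of MLPs $\phi_{\rm diag},\rho_{\rm diag},\phi_{\rm off},\rho_{\rm off},\zeta$ and computes $$z_j=\zeta\Big(\rho_{\rm diag}\Big(\sum_{k\ne j}\phi_{\rm diag}(d_{jk})\Big),\ \rho_{\rm off}\Big(\sum_{k<l;\ k,l\ne j}\phi_{\rm off}(o_{kl})\Big),\ s_j\Big)\in\mathbb R^{d},$$ where $d_{jk}$ consists of $v_j,v_k,\Sigma_{jj},\Sigma_{kk},\Sigma_{jk}$ and any fixed finite number (possibly zero) of functions of these, $o_{kl}$ consists of $\Sigma_{kl}$ and any fixed finite number (possibly zero) of functions of $(v_k,v_l,\Sigma_{kk},\Sigma_{ll},\Sigma_{kl})$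 that are symmetric in $k,l$, and $s_j$ is a fixed, possibly empty, permutation-equivariant vector of pass-through features of alternative $j$. The full architecture stacks $z_1,\dots,z_K$ (computed with the same encoder weights) as the rows of a matrix $Z$, applies one or more layers $L(Z)=\sigma\big(ZA+\tfrac1K\mathbf 1\mathbf 1^\top ZB+\mathbf 1c^\top\big)$ of arbitrary widths, multiplies the result by a vector $a$ to obtain one logit per alternative, and outputs $\hat P_j=\exp(\mathrm{logit}_j)/\sum_k\exp(\mathrm{logit}_k)$. Then, for every choice of the additional features: 1. For every $j$, every compact $C\subset\mathcal X_K\setminus(\mathcal B_j\cup\mathcal T_j)$ and every $\varepsilon>0$ there is a per-alternative encoder with output dimension $1$ such that $|z_j(v,\Sigma)-P_j(v,\Sigma)|<\varepsilon$ for all $(v,\Sigma)\in C$. 2. For every compact $C\subset\mathcal X_K\setminus\bigcup_{j}\mathcal B_j$ and every $\varepsilon>0$ there is a network of the full architecture such that $|\hat P_j(v,\Sigma)-P_j(v,\Sigma)|<\varepsilon$ for all $j$ and all $(v,\Sigma)\in C$. -/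

import Mathlib

/-- A choice problem with `K` alternatives: deterministic utilities and a scale matrix. -/
abbrev ChoiceInput (K : ℕ) : Type := (Fin K → ℝ) × Matrix (Fin K) (Fin K) ℝ

/-- `f` is a Lebesgue density on `ℝ^K` that is invariant under permutations of the coordinates. -/
structure IsExchangeableDensity {K : ℕ} (f : (Fin K → ℝ) → ℝ) : Prop where
  measurable : Measurable f
  nonneg : ∀ e, 0 ≤ f e
  integrable : MeasureTheory.Integrable f
  integral_eq_one : ∫ e, f e = 1
  exchangeable : ∀ (π : Equiv.Perm (Fin K)) (e : Fin K → ℝ), f (e ∘ π) = f e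

open scoped MatrixOrder in
/-- The symmetric positive semidefinite square root of a positive semidefinite matrix. -/
noncomputable def scaleSqrt {K : ℕ} (S : Matrix (Fin K) (Fin K) ℝ) :
    Matrix (Fin K) (Fin K) ℝ :=
  CFC.sqrt S

/-- The set of error vectors `e` for which alternative `j` maximizes the utilities
`U_k = v_k + (Σ^{1/2} e)_k`. -/
def choiceRegion {K : ℕ} (j : Fin K) (x : ChoiceInput K) : Set (Fin K → ℝ) :=
  {e | ∀ k, k ≠ j →
    x.1 k + (scaleSqrt x.2).mulVec e k ≤ x.1 j + (scaleSqrt x.2).mulVec e j}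

/-- The probability `P_j(v, Σ)` that alternative `j` is chosen. -/
noncomputable def choiceProb {K : ℕ} (f : (Fin K → ℝ) → ℝ) (j : Fin K) (x : ChoiceInput K) : ℝ :=
  ∫ e in choiceRegion j x, f e

/-- The space of centered and scale-normalized inputs. -/
def inputSpace (K : ℕ) : Set (ChoiceInput K) :=
  {x | ∑ k, x.1 k = 0 ∧ x.2.mulVec (fun _ => 1) = 0 ∧ x.2.trace = K ∧ x.2.PosSemidef}

/-- The above-diagonal positions `(k, l)`, `k < l`, of the matrix without row and column `j`. -/
def offPositions {K : ℕ} (j : Fin K) : Finset (Fin K × Fin K) :=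
  Finset.univ.filter fun p => p.1 < p.2 ∧ p.1 ≠ j ∧ p.2 ≠ j

/-- The triples `(v_k, Σ_kk, Σ_jk)`, `k ≠ j`, are pairwise distinct, and so are the off-diagonal
entries of the matrix without row and column `j`. -/
def DistinctAt {K : ℕ} (j : Fin K) (x : ChoiceInput K) : Prop :=
  Set.InjOn (fun k => (x.1 k, x.2 k k, x.2 j k)) {k | k ≠ j} ∧
  Set.InjOn (fun p : Fin K × Fin K => x.2 p.1 p.2) (offPositions j : Set (Fin K × Fin K))

/-- For each `k ≠ j`, exactly one set of `K - 2` off-diagonal positions avoiding `j` has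
entries adding up to `-Σ_kk - Σ_jk`. -/
def UniqueSumsAt {K : ℕ} (j : Fin K) (x : ChoiceInput K) : Prop :=
  ∀ k, k ≠ j → ∃! S : Finset (Fin K × Fin K),
    S ∈ (offPositions j).powersetCard (K - 2) ∧ ∑ p ∈ S, x.2 p.1 p.2 = -x.2 k k - x.2 j k

/-- The exceptional set `B_j`. -/
def exceptionalSet {K : ℕ} (j : Fin K) : Set (ChoiceInput K) :=
  {x | x ∈ inputSpace K ∧ ¬ (DistinctAt j x ∧ UniqueSumsAt j x)}

/-- Inputs at which alternative `j` ties with another alternative for every error vector: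
the deterministic utilities agree, and `Σ_jj + Σ_kk - 2 Σ_jk`, the squared length of the difference
of the rows `j` and `k` of `Σ^{1/2}`, vanishes. -/
def certainTieSet {K : ℕ} (j : Fin K) : Set (ChoiceInput K) :=
  {x | ∃ k, k ≠ j ∧ x.1 j = x.1 k ∧ x.2 j j + x.2 k k - 2 * x.2 j k = 0}

/-- Weights of a multi-layer perceptron from `ℝ^m` to `ℝ^n`: finitely many hidden layers
of arbitrary widths, followed by an affine output layer. -/
inductive MLP : ℕ → ℕ → Type
  | output {m n : ℕ} (W : Matrix (Fin n) (Fin m) ℝ) (b : Fin n → ℝ) : MLP m n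
  | hidden {m h n : ℕ} (W : Matrix (Fin h) (Fin m) ℝ) (b : Fin h → ℝ) (rest : MLP h n) : MLP m n

/-- The function computed by a multi-layer perceptron with activation function `σ`. -/
def MLP.eval (σ : ℝ → ℝ) : {m n : ℕ} → MLP m n → (Fin m → ℝ) → (Fin n → ℝ)
  | _, _, .output W b, x => W.mulVec x + b
  | _, _, .hidden W b rest, x => rest.eval σ fun i => σ ((W.mulVec x + b) i)

/-- A choice of features that are fed to the encoder in addition to the base inputs; there may
be none (all dimensions `0`). -/
structure ExtraFeatures (K : ℕ) where
  /-- number of additional features of a pair `(j, k)` -/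
  dDiag : ℕ
  /-- number of additional features of an unordered pair `{k, l}` -/
  dOff : ℕ
  /-- number of pass-through features -/
  dPass : ℕ
  /-- additional features as functions of `v_j, v_k, Σ_jj, Σ_kk, Σ_jk` -/
  diag : ℝ → ℝ → ℝ → ℝ → ℝ → Fin dDiag → ℝ
  /-- additional features as functions of `v_k, v_l, Σ_kk, Σ_ll, Σ_kl` -/
  off : ℝ → ℝ → ℝ → ℝ → ℝ → Fin dOff → ℝ
  /-- pass-through features of alternative `j` -/
  pass : Fin K → ChoiceInput K → Fin dPass → ℝ
  off_symm : ∀ u u' s s' c, off u u' s s' c = off u' u s' s c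
  pass_equivariant : ∀ (π : Equiv.Perm (Fin K)) (j : Fin K) (x : ChoiceInput K),
    pass j (x.1 ∘ π, x.2.submatrix π π) = pass (π j) x

/-- The input of the diagonal DeepSet for the pair `(j, k)`. -/
def ExtraFeatures.diagInput {K : ℕ} (F : ExtraFeatures K) (x : ChoiceInput K) (j k : Fin K) :
    Fin (5 + F.dDiag) → ℝ :=
  Fin.append ![x.1 j, x.1 k, x.2 j j, x.2 k k, x.2 j k]
    (F.diag (x.1 j) (x.1 k) (x.2 j j) (x.2 k k) (x.2 j k))

/-- The input of the off-diagonal DeepSet for the pair `{k, l}`. -/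
def ExtraFeatures.offInput {K : ℕ} (F : ExtraFeatures K) (x : ChoiceInput K) (k l : Fin K) :
    Fin (1 + F.dOff) → ℝ :=
  Fin.append ![x.2 k l] (F.off (x.1 k) (x.1 l) (x.2 k k) (x.2 l l) (x.2 k l))

/-- Weights of a per-alternative encoder with output dimension `d`. -/
structure Encoder {K : ℕ} (F : ExtraFeatures K) (d : ℕ) where
  /-- width of the sum in the diagonal DeepSet -/
  mDiag : ℕ
  /-- output dimension of the diagonal DeepSet -/
  nDiag : ℕ
  /-- width of the sum in the off-diagonal DeepSet -/
  mOff : ℕ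
  /-- output dimension of the off-diagonal DeepSet -/
  nOff : ℕ
  phiDiag : MLP (5 + F.dDiag) mDiag
  rhoDiag : MLP mDiag nDiag
  phiOff : MLP (1 + F.dOff) mOff
  rhoOff : MLP mOff nOff
  zeta : MLP (nDiag + nOff + F.dPass) d

/-- Output of the diagonal DeepSet for alternative `j`. -/
def Encoder.hDiag {K d : ℕ} {F : ExtraFeatures K} (E : Encoder F d) (σ : ℝ → ℝ)
    (j : Fin K) (x : ChoiceInput K) : Fin E.nDiag → ℝ :=
  E.rhoDiag.eval σ (∑ k ∈ Finset.univ.filter (fun k => k ≠ j), E.phiDiag.eval σ (F.diagInput x j k))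

/-- Output of the off-diagonal DeepSet for alternative `j`. -/
def Encoder.hOff {K d : ℕ} {F : ExtraFeatures K} (E : Encoder F d) (σ : ℝ → ℝ)
    (j : Fin K) (x : ChoiceInput K) : Fin E.nOff → ℝ :=
  E.rhoOff.eval σ (∑ p ∈ offPositions j, E.phiOff.eval σ (F.offInput x p.1 p.2))

/-- The representation `z_j` of alternative `j`. -/
def Encoder.eval {K d : ℕ} {F : ExtraFeatures K} (E : Encoder F d) (σ : ℝ → ℝ)
    (j : Fin K) (x : ChoiceInput K) : Fin d → ℝ :=
  E.zeta.eval σ (Fin.append (Fin.append (E.hDiag σ j x) (E.hOff σ j x)) (F.pass j x))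

/-- Weights of a permutation-equivariant layer. -/
structure EquivariantLayer (m n : ℕ) where
  A : Matrix (Fin m) (Fin n) ℝ
  B : Matrix (Fin m) (Fin n) ℝ
  c : Fin n → ℝ

/-- `L(Z) = σ(Z A + K⁻¹ 1 1ᵀ Z B + 1 cᵀ)`, with `σ` applied entrywise. -/
noncomputable def EquivariantLayer.eval {K m n : ℕ} (L : EquivariantLayer m n) (σ : ℝ → ℝ)
    (Z : Matrix (Fin K) (Fin m) ℝ) : Matrix (Fin K) (Fin n) ℝ :=
  Matrix.of fun k i => σ ((Z * L.A) k i + (1 / (K : ℝ)) * ∑ l, (Z * L.B) l i + L.c i)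

/-- One or more consecutive equivariant layers. -/
inductive EquivariantStack : ℕ → ℕ → Type
  | single {m n : ℕ} (L : EquivariantLayer m n) : EquivariantStack m n
  | cons {m h n : ℕ} (L : EquivariantLayer m h) (rest : EquivariantStack h n) :
      EquivariantStack m n

/-- The map computed by consecutive equivariant layers. -/
noncomputable def EquivariantStack.eval {K : ℕ} (σ : ℝ → ℝ) : {m n : ℕ} →
    EquivariantStack m n → Matrix (Fin K) (Fin m) ℝ → Matrix (Fin K) (Fin n) ℝ
  | _, _, .single L, Z => L.eval σ Z
  | _, _, .cons L rest, Z => rest.eval σ (L.eval σ Z)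

/-- Weights of the full architecture. -/
structure Network {K : ℕ} (F : ExtraFeatures K) where
  dz : ℕ
  dL : ℕ
  encoder : Encoder F dz
  layers : EquivariantStack dz dL
  a : Fin dL → ℝ

/-- The logits `Z^{(L)} a`. -/
noncomputable def Network.logit {K : ℕ} {F : ExtraFeatures K} (N : Network F) (σ : ℝ → ℝ)
    (x : ChoiceInput K) : Fin K → ℝ :=
  (N.layers.eval σ (Matrix.of fun j => N.encoder.eval σ j x)).mulVec N.a

/-- The emulated choice probabilities, the softmax of the logits. -/
noncomputable def Network.prob {K : ℕ} {F : ExtraFeatures K} (N : Network F) (σ : ℝ → ℝ)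
    (x : ChoiceInput K) (j : Fin K) : ℝ :=
  Real.exp (N.logit σ x j) / ∑ k, Real.exp (N.logit σ x k)

/-! ### Universal approximation with a smooth non-polynomial activation function -/

/-! Two facts combine. First, the encoder's data determine `(j, x)` up to relabelling outside the
exceptional sets (`exists_perm_of_data_eq`). The pairs `(j, k)` match the alternatives. Since the
rows of `Σ` sum to zero, the entries of row `k` away from columns `j` and `k` have a known sum, so
uniqueness of subset sums recovers which unordered entries lie in row `k`; two rows then meet in
exactly one entry. As `f` is exchangeable and the symmetric square root commutes with relabelling,
the choice probability is a function of the data. It is continuous away from certain ties, by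
dominated convergence.

Second, pooled networks approximate every continuous function of the data. On a compact space, the
functions `σ (h + b)` with `h` in a linear space `H` span a dense subspace of the continuous
functions constant on the fibres of `H` (`exists_sum_ridge_close`): derivatives in the scale of `h`
give powers, powers give exponentials, and Stone–Weierstrass applies. Taking `H` to be the sums of
pooled one-hidden-layer networks, its fibres are governed by the data, because pooled neurons reveal
which vectors occur (`exists_eq_of_sum_ridge_eq`). No explicit injective encoding of multisets is
needed.

For the softmax output, the same approximation is made jointly in `(j, x)` with the logits `log (P_j
+ δ)`; certain ties are then excluded automatically. -/

theorem exists_polynomial_of_iteratedDeriv_eq_zero (k : ℕ) :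
    ∀ g : ℝ → ℝ, ContDiff ℝ (⊤ : ℕ∞) g → (∀ t, iteratedDeriv k g t = 0) →
      ∃ p : Polynomial ℝ, ∀ t, g t = p.eval t := by
  induction k with
  | zero =>
    intro g _ h
    exact ⟨0, fun t => by simpa using h t⟩
  | succ k ih =>
    intro g hg h
    have hd : ContDiff ℝ (⊤ : ℕ∞) (deriv g) := by
      exact (contDiff_infty_iff_deriv.1 hg).2
    have hdiff : Differentiable ℝ g := hg.differentiable (by simp)
    obtain ⟨p, hp⟩ := ih (deriv g) hd fun t => by
      rw [← iteratedDeriv_succ']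
      exact h t
    -- The formal antiderivative of `p`; it differs from `g` by a constant.
    let q : Polynomial ℝ := p.sum fun n a => Polynomial.monomial (n + 1) (a / (n + 1))
    have hq : Polynomial.derivative q = p := by
      conv_rhs => rw [← Polynomial.sum_monomial_eq p]
      simp only [q, Polynomial.sum, Polynomial.derivative_sum, Polynomial.derivative_monomial]
      refine Finset.sum_congr rfl fun n _ => ?_
      have : ((n : ℝ) + 1) ≠ 0 := by positivity
      simp [this]
    have hconst : ∀ t, g t - q.eval t = g 0 - q.eval 0 := by
      intro t
      refine is_const_of_deriv_eq_zero (f := fun t => g t - q.eval t)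
        (hdiff.sub q.differentiable) (fun s => ?_) t 0
      rw [deriv_fun_sub (hdiff s) q.differentiableAt, hp, Polynomial.deriv, hq, sub_self]
    refine ⟨q + Polynomial.C (g 0 - q.eval 0), fun t => ?_⟩
    have := hconst t
    simp only [Polynomial.eval_add, Polynomial.eval_C]
    linarith

/-! ### Density of spans of ridge functions -/

section Abstract

variable {D : Type*} [TopologicalSpace D]

/-- The ridge function `x ↦ g (h x + b)`. -/
def ridge (g : C(ℝ, ℝ)) (h : C(D, ℝ)) (b : ℝ) : C(D, ℝ) := g.comp (h + ContinuousMap.const D b)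

@[simp]
theorem ridge_apply (g : C(ℝ, ℝ)) (h : C(D, ℝ)) (b : ℝ) (x : D) : ridge g h b x = g (h x + b) :=
  rfl

theorem exists_sum_of_mem_span_ridge {H : Submodule ℝ C(D, ℝ)} {g : C(ℝ, ℝ)} {u : C(D, ℝ)}
    (hu : u ∈ Submodule.span ℝ {u | ∃ h ∈ H, ∃ b : ℝ, u = ridge g h b}) :
    ∃ (n : ℕ) (h : Fin n → C(D, ℝ)) (a b : Fin n → ℝ), (∀ i, h i ∈ H) ∧
      ∀ x, u x = ∑ i, a i * g (h i x + b i) := by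
  obtain ⟨n, a, v, hv⟩ := Submodule.mem_span_set'.1 hu
  choose h hh b hb using fun i => (v i).2
  refine ⟨n, h, a, b, hh, fun x => ?_⟩
  rw [← hv]
  simp [hb, ContinuousMap.sum_apply]

variable [CompactSpace D]

/-- The uniform closure of the linear span of the ridge functions over `H`. -/
noncomputable def ridgeClosure (g : C(ℝ, ℝ)) (H : Submodule ℝ C(D, ℝ)) : Submodule ℝ C(D, ℝ) :=
  (Submodule.span ℝ {u | ∃ h ∈ H, ∃ b : ℝ, u = ridge g h b}).topologicalClosure

/-- Uniform convergence of the difference quotients of a continuously differentiable function. -/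
theorem exists_differenceQuotient_close {g : ℝ → ℝ} (hg : Differentiable ℝ g)
    (hg' : Continuous (deriv g)) (u h : C(D, ℝ)) {ε : ℝ} (hε : 0 < ε) :
    ∃ t : ℝ, t ≠ 0 ∧ ∀ x, |(g (u x + t * h x) - g (u x)) / t - h x * deriv g (u x)| ≤ ‖h‖ * ε := by
  -- For `0 < t ≤ 1` all segments from `u x` to `u x + t * h x` stay in `[-R, R]`, where `deriv g`
  -- is uniformly continuous.
  set R := ‖u‖ + 1 + ‖h‖
  have hu : UniformContinuousOn (deriv g) (Set.Icc (-R) R) :=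
    isCompact_Icc.uniformContinuousOn_of_continuous hg'.continuousOn
  obtain ⟨δ, hδ, hu⟩ := Metric.uniformContinuousOn_iff.1 hu ε hε
  have hh : 0 ≤ ‖h‖ := norm_nonneg h
  obtain ⟨t, ht0, ht1, htδ⟩ : ∃ t : ℝ, 0 < t ∧ t ≤ 1 ∧ t * ‖h‖ < δ := by
    refine ⟨min 1 (δ / (2 * (‖h‖ + 1))), by positivity, min_le_left _ _, ?_⟩
    calc min 1 (δ / (2 * (‖h‖ + 1))) * ‖h‖ ≤ δ / (2 * (‖h‖ + 1)) * (‖h‖ + 1) := by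
          gcongr
          · exact min_le_right _ _
          · linarith
      _ = δ / 2 := by field_simp
      _ < δ := by linarith
  refine ⟨t, ht0.ne', fun x => ?_⟩
  have hux : |u x| ≤ ‖u‖ := u.norm_coe_le_norm x
  have hhx : |h x| ≤ ‖h‖ := h.norm_coe_le_norm x
  have hthx : |t * h x| ≤ t * ‖h‖ := by
    rw [abs_mul, abs_of_pos ht0]; gcongr
  have htR : t * ‖h‖ ≤ ‖h‖ := by nlinarith
  have hseg : ∀ y ∈ Set.uIcc (u x) (u x + t * h x),
      ‖deriv g y - deriv g (u x)‖ ≤ ε := by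
    intro y hy
    have hyd : |y - u x| ≤ |t * h x| := by
      have := Set.abs_sub_left_of_mem_uIcc hy
      simpa using this
    have h1 := abs_le.1 hyd
    have h2 := abs_le.1 hux
    have h3 := (abs_le.1 hthx)
    have hyR : y ∈ Set.Icc (-R) R := by
      constructor <;> simp only [R] <;> linarith
    have huR : u x ∈ Set.Icc (-R) R := by
      constructor <;> simp only [R] <;> linarith
    have := hu y hyR (u x) huR (by rw [Real.dist_eq]; linarith)
    rw [Real.dist_eq] at this
    exact this.le
  -- Mean value inequality after subtracting the linear part at `u x`, so that the derivative is at
  -- most `ε` along the segment.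
  have hmv := (convex_uIcc (u x) (u x + t * h x)).norm_image_sub_le_of_norm_hasDerivWithin_le
    (f := fun y => g y - deriv g (u x) * y) (f' := fun y => deriv g y - deriv g (u x)) (C := ε)
    (fun y _ => by
      have := ((hg y).hasDerivAt.fun_sub ((hasDerivAt_id' y).const_mul (deriv g (u x))))
      rw [mul_one] at this
      exact this.hasDerivWithinAt)
    hseg Set.left_mem_uIcc Set.right_mem_uIcc
  have e1 : (g (u x + t * h x) - g (u x)) / t - h x * deriv g (u x) =
      (g (u x + t * h x) - deriv g (u x) * (u x + t * h x) - (g (u x) - deriv g (u x) * u x)) / t := by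
    field_simp
    ring
  rw [e1, abs_div, abs_of_pos ht0, div_le_iff₀ ht0]
  simp only [Real.norm_eq_abs, add_sub_cancel_left] at hmv
  calc _ ≤ ε * |t * h x| := hmv
    _ ≤ ε * (t * ‖h‖) := by gcongr
    _ = ‖h‖ * ε * t := by ring

variable {σ : C(ℝ, ℝ)} {H : Submodule ℝ C(D, ℝ)}

theorem ridge_mem_ridgeClosure {h : C(D, ℝ)} (hh : h ∈ H) (b : ℝ) :
    ridge σ h b ∈ ridgeClosure σ H :=
  Submodule.le_topologicalClosure _ (Submodule.subset_span ⟨h, hh, b, rfl⟩)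

theorem isClosed_ridgeClosure : IsClosed (ridgeClosure σ H : Set C(D, ℝ)) :=
  Submodule.isClosed_topologicalClosure _

/-- Differentiating `σ (l * h + b)` in `l` brings down one factor `h` and raises the order of the
derivative by one. The difference quotients in `l` stay in the closed span and converge uniformly.
-/
theorem pow_mul_ridge_iteratedDeriv_mem (hσ : ContDiff ℝ (⊤ : ℕ∞) σ) {h : C(D, ℝ)} (hh : h ∈ H)
    (k : ℕ) : ∀ (g : C(ℝ, ℝ)), (∀ t, g t = iteratedDeriv k σ t) →
      ∀ l b : ℝ, h ^ k * ridge g (l • h) b ∈ ridgeClosure σ H := by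
  induction k with
  | zero =>
    intro g hg l b
    have : g = σ := by ext t; simpa using hg t
    subst this
    simpa using ridge_mem_ridgeClosure (H.smul_mem l hh) b
  | succ k ih =>
    intro g hg l b
    have hc : ContDiff ℝ (⊤ : ℕ∞) (iteratedDeriv k σ) :=
      iteratedDeriv_eq_iterate (f := σ) (n := k) ▸ hσ.iterate_deriv k
    let g₀ : C(ℝ, ℝ) := ⟨iteratedDeriv k σ, hc.continuous⟩
    have hgd : ∀ t, g t = deriv g₀ t := fun t => by rw [hg, iteratedDeriv_succ]; rfl
    have hd : Differentiable ℝ g₀ := hc.differentiable (by simp)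
    have hd' : Continuous (deriv g₀) := by
      have : deriv g₀ = g := by ext t; exact (hgd t).symm
      rw [this]; exact g.continuous
    refine isClosed_ridgeClosure.closure_subset (Metric.mem_closure_iff.2 fun ε hε => ?_)
    have hpos : 0 < ‖h‖ ^ k * ‖h‖ + 1 := by positivity
    obtain ⟨t, ht, hclose⟩ := exists_differenceQuotient_close hd hd'
      (l • h + ContinuousMap.const D b) h (ε := ε / 2 / (‖h‖ ^ k * ‖h‖ + 1)) (by positivity)
    refine ⟨t⁻¹ • (h ^ k * ridge g₀ ((l + t) • h) b - h ^ k * ridge g₀ (l • h) b),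
      Submodule.smul_mem _ _ (Submodule.sub_mem _ (ih g₀ (fun _ => rfl) _ _)
        (ih g₀ (fun _ => rfl) _ _)), ?_⟩
    rw [dist_comm, dist_eq_norm]
    refine lt_of_le_of_lt ((ContinuousMap.norm_le _ (C := ε / 2) (by positivity)).2 fun x => ?_)
      (by linarith)
    have h1 := hclose x
    simp only [ContinuousMap.add_apply, ContinuousMap.smul_apply, ContinuousMap.const_apply,
      smul_eq_mul] at h1
    have e : (t⁻¹ • (h ^ k * ridge g₀ ((l + t) • h) b - h ^ k * ridge g₀ (l • h) b)
        - h ^ (k + 1) * ridge g (l • h) b) x = (h x) ^ k *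
        ((g₀ (l * h x + b + t * h x) - g₀ (l * h x + b)) / t - h x * deriv g₀ (l * h x + b)) := by
      simp only [ContinuousMap.sub_apply, ContinuousMap.smul_apply, ContinuousMap.mul_apply,
        ContinuousMap.pow_apply, ridge_apply, smul_eq_mul, hgd]
      rw [show (l + t) * h x + b = l * h x + b + t * h x by ring]
      ring
    rw [e, Real.norm_eq_abs, abs_mul, abs_pow]
    have hhx : |h x| ≤ ‖h‖ := h.norm_coe_le_norm x
    calc _ ≤ ‖h‖ ^ k * (‖h‖ * (ε / 2 / (‖h‖ ^ k * ‖h‖ + 1))) := by gcongr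
      _ = (‖h‖ ^ k * ‖h‖) / (‖h‖ ^ k * ‖h‖ + 1) * (ε / 2) := by field_simp
      _ ≤ 1 * (ε / 2) := by
        gcongr
        rw [div_le_one hpos]
        linarith
      _ = ε / 2 := one_mul _

/-- At scale `l = 0` the ridge factor is the constant `iteratedDeriv k σ b`, which is nonzero for
some `b` because `σ` is not a polynomial. -/
theorem pow_mem_ridgeClosure (hσ : ContDiff ℝ (⊤ : ℕ∞) σ)
    (hσ_nonpoly : ¬ ∃ p : Polynomial ℝ, ∀ t, σ t = p.eval t) {h : C(D, ℝ)} (hh : h ∈ H) (k : ℕ) :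
    h ^ k ∈ ridgeClosure σ H := by
  obtain ⟨b, hb⟩ : ∃ b, iteratedDeriv k σ b ≠ 0 := by
    by_contra! hcon
    exact hσ_nonpoly (exists_polynomial_of_iteratedDeriv_eq_zero k σ hσ hcon)
  have hc : ContDiff ℝ (⊤ : ℕ∞) (iteratedDeriv k σ) :=
    iteratedDeriv_eq_iterate (f := σ) (n := k) ▸ hσ.iterate_deriv k
  have := Submodule.smul_mem _ (iteratedDeriv k σ b)⁻¹
    (pow_mul_ridge_iteratedDeriv_mem hσ hh k ⟨_, hc.continuous⟩ (fun _ => rfl) 0 b)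
  convert this using 1
  ext x
  simp [mul_comm, hb]

theorem exp_mem_ridgeClosure (hσ : ContDiff ℝ (⊤ : ℕ∞) σ)
    (hσ_nonpoly : ¬ ∃ p : Polynomial ℝ, ∀ t, σ t = p.eval t) {h : C(D, ℝ)} (hh : h ∈ H) :
    NormedSpace.exp h ∈ ridgeClosure σ H := by
  refine isClosed_ridgeClosure.mem_of_tendsto (NormedSpace.exp_series_hasSum_exp' (𝕂 := ℝ) h)
    (Filter.Eventually.of_forall fun s => ?_)
  exact Submodule.sum_mem _ fun k _ => Submodule.smul_mem _ _ (pow_mem_ridgeClosure hσ hσ_nonpoly hh k)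

theorem ContinuousMap.exp_apply (h : C(D, ℝ)) (x : D) :
    NormedSpace.exp h x = Real.exp (h x) := by
  rw [Real.exp_eq_exp_ℝ]
  exact NormedSpace.map_exp (ContinuousMap.evalAlgHom ℝ ℝ x) (continuous_eval_const x) h

/-- Exponentials are used because `exp h * exp h' = exp (h + h')`: those of `H` form a monoid, so
their linear span is already an algebra, and Stone–Weierstrass applies to it. -/
theorem ridgeClosure_eq_top (hσ : ContDiff ℝ (⊤ : ℕ∞) σ)
    (hσ_nonpoly : ¬ ∃ p : Polynomial ℝ, ∀ t, σ t = p.eval t)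
    (hsep : ∀ x y : D, x ≠ y → ∃ h ∈ H, h x ≠ h y) : ridgeClosure σ H = ⊤ := by
  let M : Submonoid C(D, ℝ) :=
    { carrier := {u | ∃ h ∈ H, u = NormedSpace.exp h}
      one_mem' := ⟨0, H.zero_mem, NormedSpace.exp_zero.symm⟩
      mul_mem' := by
        rintro _ _ ⟨h, hh, rfl⟩ ⟨h', hh', rfl⟩
        exact ⟨h + h', H.add_mem hh hh', (NormedSpace.exp_add (x := h) (y := h')).symm⟩ }
  have hle : Subalgebra.toSubmodule (Algebra.adjoin ℝ (M : Set C(D, ℝ))) ≤ ridgeClosure σ H := by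
    rw [Algebra.adjoin_eq_span, Submonoid.closure_eq, Submodule.span_le]
    rintro _ ⟨h, hh, rfl⟩
    exact exp_mem_ridgeClosure hσ hσ_nonpoly hh
  have htop := ContinuousMap.subalgebra_topologicalClosure_eq_top_of_separatesPoints
    (Algebra.adjoin ℝ (M : Set C(D, ℝ))) (by
      intro x y hxy
      obtain ⟨h, hh, hne⟩ := hsep x y hxy
      refine ⟨_, ⟨NormedSpace.exp h, Algebra.subset_adjoin ⟨h, hh, rfl⟩, rfl⟩, ?_⟩
      simpa [ContinuousMap.exp_apply] using hne)
  rw [eq_top_iff]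
  intro u _
  have hu : u ∈ (Algebra.adjoin ℝ (M : Set C(D, ℝ))).topologicalClosure := by
    rw [htop]; trivial
  exact closure_minimal (fun v hv => hle hv) isClosed_ridgeClosure hu

/-- **Universal approximation.** A continuous function on a compact space that is constant on the
fibres of a linear space `H` of continuous functions is a uniform limit of linear combinations
of the functions `σ (h + b)` with `h ∈ H`. -/
theorem exists_sum_ridge_close (hσ : ContDiff ℝ (⊤ : ℕ∞) σ)
    (hσ_nonpoly : ¬ ∃ p : Polynomial ℝ, ∀ t, σ t = p.eval t) (G : C(D, ℝ))
    (hG : ∀ x y : D, (∀ h ∈ H, h x = h y) → G x = G y) {ε : ℝ} (hε : 0 < ε) :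
    ∃ (n : ℕ) (h : Fin n → C(D, ℝ)) (a b : Fin n → ℝ), (∀ i, h i ∈ H) ∧
      ∀ x, |∑ i, a i * σ (h i x + b i) - G x| < ε := by
  -- On the quotient by the fibres of `H`, both `H` and `G` descend, and `H` separates points.
  let s : Setoid D :=
    { r := fun x y => ∀ h ∈ H, h x = h y
      iseqv := ⟨fun _ _ _ => rfl, fun hxy h hh => (hxy h hh).symm,
        fun hxy hyz h hh => (hxy h hh).trans (hyz h hh)⟩ }
  let mk : C(D, Quotient s) := ⟨Quotient.mk s, continuous_quotient_mk'⟩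
  let H' : Submodule ℝ C(Quotient s, ℝ) :=
    { carrier := {h | h.comp mk ∈ H}
      zero_mem' := H.zero_mem
      add_mem' := fun ha hb => H.add_mem ha hb
      smul_mem' := fun c _ ha => H.smul_mem c ha }
  let G' : C(Quotient s, ℝ) := ⟨Quotient.lift G hG, G.continuous.quotient_lift hG⟩
  have htop : ridgeClosure σ H' = ⊤ := by
    refine ridgeClosure_eq_top hσ hσ_nonpoly fun x y => ?_
    induction x using Quotient.inductionOn
    induction y using Quotient.inductionOn
    rename_i x y
    intro hxy
    have : ¬ ∀ h ∈ H, h x = h y := fun hcon => hxy (Quotient.sound hcon)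
    push Not at this
    obtain ⟨h, hh, hne⟩ := this
    have hl : ∀ a b : D, a ≈ b → h a = h b := fun a b hab => hab h hh
    exact ⟨⟨Quotient.lift h hl, h.continuous.quotient_lift hl⟩, hh, hne⟩
  have hmem : G' ∈ ridgeClosure σ H' := by rw [htop]; trivial
  obtain ⟨u, hu, hdist⟩ := Metric.mem_closure_iff.1 hmem ε hε
  obtain ⟨n, h, a, b, hh, hsum⟩ := exists_sum_of_mem_span_ridge hu
  refine ⟨n, fun i => (h i).comp mk, a, b, hh, fun x => ?_⟩
  have h1 := (ContinuousMap.dist_lt_iff hε).1 hdist (mk x)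
  rw [dist_comm, Real.dist_eq, hsum] at h1
  exact h1

end Abstract

/-! ### Recovering the vectors of a finite family from pooled sums -/

open Classical in
/-- If all sums of ridge functions over two finite families of vectors agree, then each vector of
the first family occurs in the second one. -/
theorem exists_eq_of_sum_ridge_eq {σ : C(ℝ, ℝ)} (hσ : ContDiff ℝ (⊤ : ℕ∞) σ)
    (hσ_nonpoly : ¬ ∃ p : Polynomial ℝ, ∀ t, σ t = p.eval t) {m : ℕ} {ι ι' : Type*}
    (s : Finset ι) (s' : Finset ι') (d : ι → Fin m → ℝ) (d' : ι' → Fin m → ℝ)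
    (hsum : ∀ (w : Fin m → ℝ) (b : ℝ),
      ∑ k ∈ s, σ (w ⬝ᵥ d k + b) = ∑ k ∈ s', σ (w ⬝ᵥ d' k + b)) :
    ∀ k ∈ s, ∃ k' ∈ s', d' k' = d k := by
  intro k₀ hk₀
  by_contra! hcon
  -- On this finite discrete space the indicator of `d k₀` is approximated by ridge sums. Its sum is
  -- at least `1` over the first family and `0` over the second.
  let Q : Finset (Fin m → ℝ) := s.image d ∪ s'.image d'
  have hQ : ∀ k ∈ s, d k ∈ Q := fun k hk => by simp only [Q, Finset.mem_union, Finset.mem_image]; grind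
  have hQ' : ∀ k ∈ s', d' k ∈ Q := fun k hk => by simp only [Q, Finset.mem_union, Finset.mem_image]; grind
  let lin : (Fin m → ℝ) → C(Q, ℝ) := fun w => ⟨fun x => w ⬝ᵥ x.1, continuous_of_discreteTopology⟩
  let H : Submodule ℝ C(Q, ℝ) :=
    { carrier := Set.range lin
      zero_mem' := ⟨0, by ext x; simp [lin]⟩
      add_mem' := by
        rintro _ _ ⟨w, rfl⟩ ⟨w', rfl⟩
        exact ⟨w + w', by ext x; simp [lin, add_dotProduct]⟩
      smul_mem' := by
        rintro c _ ⟨w, rfl⟩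
        exact ⟨c • w, by ext x; simp [lin]⟩ }
  let G : C(Q, ℝ) := ⟨fun x => if x.1 = d k₀ then 1 else 0, continuous_of_discreteTopology⟩
  -- With this tolerance the accumulated error over both families is below `1`.
  have hε : (0 : ℝ) < 1 / (s.card + s'.card + 1) := by positivity
  obtain ⟨n, h, a, b, hh, hclose⟩ := exists_sum_ridge_close (H := H) hσ hσ_nonpoly G (by
    intro x y hxy
    have : x = y := by
      ext i
      simpa [lin] using hxy (lin (Pi.single i 1)) ⟨_, rfl⟩
    rw [this]) hε
  choose w hw using hh
  let g : (Fin m → ℝ) → ℝ := fun x => ∑ i, a i * σ (w i ⬝ᵥ x + b i)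
  have hg : ∀ x (hx : x ∈ Q), |g x - if x = d k₀ then 1 else 0| < 1 / (s.card + s'.card + 1) := by
    intro x hx
    have := hclose ⟨x, hx⟩
    simp only [← hw] at this
    exact this
  have hsumg : ∑ k ∈ s, g (d k) = ∑ k ∈ s', g (d' k) := by
    simp only [g]
    rw [Finset.sum_comm, Finset.sum_comm (s := s')]
    simp only [← Finset.mul_sum, hsum]
  have h1 : |∑ k ∈ s, (g (d k) - if d k = d k₀ then 1 else 0)| ≤
      s.card * (1 / (s.card + s'.card + 1)) := by
    refine (Finset.abs_sum_le_sum_abs _ _).trans ?_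
    rw [← nsmul_eq_mul]
    exact Finset.sum_le_card_nsmul _ _ _ fun k hk => (hg _ (hQ k hk)).le
  have h2 : |∑ k ∈ s', (g (d' k) - if d' k = d k₀ then 1 else 0)| ≤
      s'.card * (1 / (s.card + s'.card + 1)) := by
    refine (Finset.abs_sum_le_sum_abs _ _).trans ?_
    rw [← nsmul_eq_mul]
    exact Finset.sum_le_card_nsmul _ _ _ fun k hk => (hg _ (hQ' k hk)).le
  have h3 : ∑ k ∈ s', (if d' k = d k₀ then (1 : ℝ) else 0) = 0 :=
    Finset.sum_eq_zero fun k hk => if_neg (hcon k hk)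
  have h4 : (1 : ℝ) ≤ ∑ k ∈ s, (if d k = d k₀ then (1 : ℝ) else 0) := by
    refine le_trans ?_ (Finset.single_le_sum (f := fun k => if d k = d k₀ then (1 : ℝ) else 0)
      (fun k _ => by positivity) hk₀)
    simp
  rw [Finset.sum_sub_distrib] at h1 h2
  have h5 : (s.card : ℝ) * (1 / (s.card + s'.card + 1)) + s'.card * (1 / (s.card + s'.card + 1)) < 1 := by
    rw [← add_mul, mul_one_div, div_lt_one (by positivity)]
    linarith
  have h6 := (abs_le.1 h1).1
  have h7 := (abs_le.1 h2).2
  linarith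

/-! ### Encoders realize sums of one-hidden-layer networks -/

/-- The functions computed by one-hidden-layer networks with `m` inputs. -/
def netSpan (σ : ℝ → ℝ) (m : ℕ) : Submodule ℝ ((Fin m → ℝ) → ℝ) :=
  Submodule.span ℝ (Set.range fun (p : (Fin m → ℝ) × ℝ) (y : Fin m → ℝ) => σ (p.1 ⬝ᵥ y + p.2))

theorem neuron_mem_netSpan (σ : ℝ → ℝ) {m : ℕ} (w : Fin m → ℝ) (b : ℝ) :
    (fun y => σ (w ⬝ᵥ y + b)) ∈ netSpan σ m :=
  Submodule.subset_span ⟨(w, b), rfl⟩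

theorem continuous_of_mem_netSpan {σ : ℝ → ℝ} (hσ : Continuous σ) {m : ℕ} {φ : (Fin m → ℝ) → ℝ}
    (hφ : φ ∈ netSpan σ m) : Continuous φ := by
  induction hφ using Submodule.span_induction with
  | mem φ h =>
    obtain ⟨p, rfl⟩ := h
    simp only [dotProduct]
    fun_prop
  | zero => exact continuous_zero
  | add _ _ _ _ h h' => exact h.add h'
  | smul c _ _ h => exact h.const_smul c

theorem Fin.append_dotProduct_append {m n : ℕ} (a c : Fin m → ℝ) (b d : Fin n → ℝ) :
    Fin.append a b ⬝ᵥ Fin.append c d = a ⬝ᵥ c + b ⬝ᵥ d := by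
  simp [dotProduct, Fin.sum_univ_add]

open Classical in
/-- Finitely many one-hidden-layer networks are the components of a multi-layer perceptron, which
may be fed with additional inputs that it ignores. -/
theorem exists_mlp_of_mem_netSpan {σ : ℝ → ℝ} {m n : ℕ} (e : ℕ) (φ : Fin n → (Fin m → ℝ) → ℝ)
    (hφ : ∀ i, φ i ∈ netSpan σ m) :
    ∃ M : MLP (m + e) n, ∀ (y : Fin m → ℝ) (y' : Fin e → ℝ) (i : Fin n),
      M.eval σ (Fin.append y y') i = φ i y := by
  choose c hc using fun i => Finsupp.mem_span_range_iff_exists_finsupp.1 (hφ i)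
  -- All neurons used by any component form one shared hidden layer; the additional inputs get
  -- weight zero.
  let T : Finset ((Fin m → ℝ) × ℝ) := Finset.univ.biUnion fun i => (c i).support
  let p : Fin T.card → (Fin m → ℝ) × ℝ := fun t => (T.equivFin.symm t).1
  refine ⟨.hidden (Matrix.of fun t => Fin.append (p t).1 0) (fun t => (p t).2)
    (.output (Matrix.of fun i t => c i (p t)) 0), fun y y' i => ?_⟩
  have hsupp : (c i).support ⊆ T := Finset.subset_biUnion_of_mem (fun i => (c i).support)
    (Finset.mem_univ i)
  rw [← hc i, Finsupp.sum_of_support_subset _ hsupp _ (by simp), Finset.sum_apply]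
  simp only [MLP.eval, Matrix.mulVec, Matrix.of_apply, Pi.add_apply, Fin.append_dotProduct_append,
    zero_dotProduct, add_zero, Pi.zero_apply, Pi.smul_apply, smul_eq_mul]
  rw [dotProduct, ← Finset.sum_coe_sort T, ← T.equivFin.symm.sum_comp]

/-! ### Pooled sums and their realization by the architecture -/

/-- The base inputs of the diagonal DeepSet. -/
def baseDiag {K : ℕ} (q : Fin K × ChoiceInput K) (k : Fin K) : Fin 5 → ℝ :=
  ![q.2.1 q.1, q.2.1 k, q.2.2 q.1 q.1, q.2.2 k k, q.2.2 q.1 k]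

/-- The base inputs of the off-diagonal DeepSet. -/
def baseOff {K : ℕ} (q : Fin K × ChoiceInput K) (p : Fin K × Fin K) : Fin 1 → ℝ :=
  ![q.2.2 p.1 p.2]

/-- The sum of `φ` over the pairs `(j, k)`, `k ≠ j`. -/
def diagSum {K : ℕ} (φ : (Fin 5 → ℝ) → ℝ) (q : Fin K × ChoiceInput K) : ℝ :=
  ∑ k ∈ Finset.univ.filter (fun k => k ≠ q.1), φ (baseDiag q k)

/-- The sum of `ψ` over the positions that avoid `j`. -/
def offSum {K : ℕ} (ψ : (Fin 1 → ℝ) → ℝ) (q : Fin K × ChoiceInput K) : ℝ :=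
  ∑ p ∈ offPositions q.1, ψ (baseOff q p)

theorem continuous_diagSum {K : ℕ} {φ : (Fin 5 → ℝ) → ℝ} (hφ : Continuous φ) :
    Continuous (diagSum (K := K) φ) := by
  refine continuous_prod_of_discrete_left.2 fun j => ?_
  simp only [diagSum, baseDiag]
  refine continuous_finsetSum _ fun k _ => hφ.comp (continuous_pi fun i => ?_)
  fin_cases i <;> simp <;> fun_prop

theorem continuous_offSum {K : ℕ} {ψ : (Fin 1 → ℝ) → ℝ} (hψ : Continuous ψ) :
    Continuous (offSum (K := K) ψ) := by
  refine continuous_prod_of_discrete_left.2 fun j => ?_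
  simp only [offSum, baseOff]
  refine continuous_finsetSum _ fun k _ => hψ.comp (continuous_pi fun i => ?_)
  fin_cases i
  simp
  fun_prop

/-- Continuous functions of `(j, x)` that only depend on the data seen by the encoder are uniformly
approximated by one-hidden-layer networks of sums of one-hidden-layer networks. -/
theorem exists_sum_deepSet_close {K : ℕ} {σ : ℝ → ℝ} (hσ : ContDiff ℝ (⊤ : ℕ∞) σ)
    (hσ_nonpoly : ¬ ∃ p : Polynomial ℝ, ∀ t, σ t = p.eval t) {S : Set (Fin K × ChoiceInput K)}
    (hS : IsCompact S) {G : Fin K × ChoiceInput K → ℝ} (hGc : ContinuousOn G S)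
    (hG : ∀ q ∈ S, ∀ q' ∈ S,
      (∀ k, k ≠ q.1 → ∃ k', k' ≠ q'.1 ∧ baseDiag q' k' = baseDiag q k) →
      (∀ p ∈ offPositions q.1, ∃ p' ∈ offPositions q'.1, baseOff q' p' = baseOff q p) → G q = G q')
    {ε : ℝ} (hε : 0 < ε) :
    ∃ (n : ℕ) (φ : Fin n → (Fin 5 → ℝ) → ℝ) (ψ : Fin n → (Fin 1 → ℝ) → ℝ) (a b : Fin n → ℝ),
      (∀ i, φ i ∈ netSpan σ 5) ∧ (∀ i, ψ i ∈ netSpan σ 1) ∧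
      ∀ q ∈ S, |∑ i, a i * σ (diagSum (φ i) q + offSum (ψ i) q + b i) - G q| < ε := by
  have : CompactSpace S := isCompact_iff_compactSpace.1 hS
  let s : C(ℝ, ℝ) := ⟨σ, hσ.continuous⟩
  let H : Submodule ℝ C(S, ℝ) :=
    { carrier := {h | ∃ φ ∈ netSpan σ 5, ∃ ψ ∈ netSpan σ 1,
        ∀ q : S, h q = diagSum φ q.1 + offSum ψ q.1}
      zero_mem' := ⟨0, zero_mem _, 0, zero_mem _, fun q => by simp [diagSum, offSum]⟩
      add_mem' := by
        rintro h h' ⟨φ, hφ, ψ, hψ, e⟩ ⟨φ', hφ', ψ', hψ', e'⟩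
        refine ⟨φ + φ', add_mem hφ hφ', ψ + ψ', add_mem hψ hψ', fun q => ?_⟩
        simp only [ContinuousMap.add_apply, e, e', diagSum, offSum, Pi.add_apply,
          Finset.sum_add_distrib]
        ring
      smul_mem' := by
        rintro c h ⟨φ, hφ, ψ, hψ, e⟩
        refine ⟨c • φ, Submodule.smul_mem _ c hφ, c • ψ, Submodule.smul_mem _ c hψ, fun q => ?_⟩
        simp only [ContinuousMap.smul_apply, e, diagSum, offSum, Pi.smul_apply, smul_eq_mul,
          ← Finset.mul_sum]
        ring }
  obtain ⟨n, h, a, b, hh, hclose⟩ := exists_sum_ridge_close (σ := s) (H := H) hσ hσ_nonpoly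
    ⟨S.domRestrict G, hGc.domRestrict⟩ (by
      intro q q' hqq
      -- Points in the same fibre of `H` have equal pooled neurons: take a single neuron in one
      -- summand and zero in the other.
      refine hG q q.2 q' q'.2 ?_ ?_
      · have := exists_eq_of_sum_ridge_eq (σ := s) hσ hσ_nonpoly
          (Finset.univ.filter fun k => k ≠ q.1.1) (Finset.univ.filter fun k => k ≠ q'.1.1)
          (baseDiag q.1) (baseDiag q'.1) (fun w b => by
            have hn := neuron_mem_netSpan σ w b
            have := hqq ⟨fun q => diagSum (fun y => σ (w ⬝ᵥ y + b)) q.1,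
              (continuous_diagSum (continuous_of_mem_netSpan hσ.continuous hn)).comp
                continuous_subtype_val⟩
              ⟨_, hn, 0, zero_mem _, fun q => by simp [offSum]⟩
            exact this)
        simpa using this
      · exact exists_eq_of_sum_ridge_eq (σ := s) hσ hσ_nonpoly
          (offPositions q.1.1) (offPositions q'.1.1)
          (baseOff q.1) (baseOff q'.1) (fun w b => by
            have hn := neuron_mem_netSpan σ w b
            have := hqq ⟨fun q => offSum (fun y => σ (w ⬝ᵥ y + b)) q.1,
              (continuous_offSum (continuous_of_mem_netSpan hσ.continuous hn)).comp
                continuous_subtype_val⟩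
              ⟨0, zero_mem _, _, hn, fun q => by simp [diagSum]⟩
            exact this)) hε
  choose φ hφ ψ hψ e using hh
  refine ⟨n, φ, ψ, a, b, hφ, hψ, fun q hq => ?_⟩
  have := hclose ⟨q, hq⟩
  simp only [e] at this
  exact this

theorem exists_encoder_of_mem_netSpan {K d n : ℕ} {σ : ℝ → ℝ} (F : ExtraFeatures K)
    {φ : Fin n → (Fin 5 → ℝ) → ℝ} {ψ : Fin n → (Fin 1 → ℝ) → ℝ}
    (hφ : ∀ i, φ i ∈ netSpan σ 5) (hψ : ∀ i, ψ i ∈ netSpan σ 1) (ζ : MLP (n + n + F.dPass) d) :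
    ∃ E : Encoder F d, ∀ j x, E.eval σ j x =
      ζ.eval σ (Fin.append (Fin.append (fun i => diagSum (φ i) (j, x))
        (fun i => offSum (ψ i) (j, x))) (F.pass j x)) := by
  obtain ⟨M, hM⟩ := exists_mlp_of_mem_netSpan F.dDiag φ hφ
  obtain ⟨M', hM'⟩ := exists_mlp_of_mem_netSpan F.dOff ψ hψ
  -- Both `ρ` networks are the identity, so the pooled sums reach `ζ` unchanged.
  refine ⟨⟨n, n, n, n, M, .output 1 0, M', .output 1 0, ζ⟩, fun j x => ?_⟩
  have h1 : ∀ k, M.eval σ (F.diagInput x j k) = fun i => φ i (baseDiag (j, x) k) :=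
    fun k => funext fun i => hM _ _ i
  have h2 : ∀ p : Fin K × Fin K, M'.eval σ (F.offInput x p.1 p.2) =
      fun i => ψ i (baseOff (j, x) p) :=
    fun p => funext fun i => hM' _ _ i
  simp only [Encoder.eval, Encoder.hDiag, Encoder.hOff, MLP.eval, Matrix.one_mulVec, add_zero, h1, h2]
  congr 3 <;> ext i <;> simp [diagSum, offSum]

/-- A single encoder approximates, for all alternatives, a function of the encoder's data. -/
theorem exists_encoder_close {K : ℕ} {σ : ℝ → ℝ} (hσ : ContDiff ℝ (⊤ : ℕ∞) σ)
    (hσ_nonpoly : ¬ ∃ p : Polynomial ℝ, ∀ t, σ t = p.eval t) (F : ExtraFeatures K)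
    {S : Set (Fin K × ChoiceInput K)}
    (hS : IsCompact S) {G : Fin K × ChoiceInput K → ℝ} (hGc : ContinuousOn G S)
    (hG : ∀ q ∈ S, ∀ q' ∈ S,
      (∀ k, k ≠ q.1 → ∃ k', k' ≠ q'.1 ∧ baseDiag q' k' = baseDiag q k) →
      (∀ p ∈ offPositions q.1, ∃ p' ∈ offPositions q'.1, baseOff q' p' = baseOff q p) → G q = G q')
    {ε : ℝ} (hε : 0 < ε) :
    ∃ E : Encoder F 1, ∀ q ∈ S, |E.eval σ q.1 q.2 0 - G q| < ε := by
  obtain ⟨n, φ, ψ, a, b, hφ, hψ, hclose⟩ :=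
    exists_sum_deepSet_close hσ hσ_nonpoly hS hGc hG hε
  -- Hidden unit `i` adds the `i`-th diagonal and the `i`-th off-diagonal sum; pass-through features
  -- are ignored.
  obtain ⟨ζ, hζ⟩ := exists_mlp_of_mem_netSpan (σ := σ) (n := 1) F.dPass
    (fun _ y => ∑ i, a i * σ (Fin.append (Pi.single i 1 : Fin n → ℝ) (Pi.single i 1) ⬝ᵥ y + b i))
    (fun _ => by
      have : (fun y => ∑ i, a i * σ (Fin.append (Pi.single i 1 : Fin n → ℝ) (Pi.single i 1) ⬝ᵥ y
          + b i)) = ∑ i, a i • fun y => σ (Fin.append (Pi.single i 1 : Fin n → ℝ)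
            (Pi.single i 1) ⬝ᵥ y + b i) := by
        ext y; simp
      rw [this]
      exact Submodule.sum_mem _ fun i _ => Submodule.smul_mem _ _ (neuron_mem_netSpan σ _ _))
  obtain ⟨E, hE⟩ := exists_encoder_of_mem_netSpan F hφ hψ ζ
  refine ⟨E, fun q hq => ?_⟩
  rw [hE, hζ]
  simpa only [Fin.append_dotProduct_append, single_one_dotProduct] using hclose q hq

/-- The logits of a network approximate, for all alternatives, a function of the encoder's data. -/
theorem exists_network_logit_close {K : ℕ} {σ : ℝ → ℝ} (hσ : ContDiff ℝ (⊤ : ℕ∞) σ)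
    (hσ_nonpoly : ¬ ∃ p : Polynomial ℝ, ∀ t, σ t = p.eval t) (F : ExtraFeatures K)
    {S : Set (Fin K × ChoiceInput K)}
    (hS : IsCompact S) {G : Fin K × ChoiceInput K → ℝ} (hGc : ContinuousOn G S)
    (hG : ∀ q ∈ S, ∀ q' ∈ S,
      (∀ k, k ≠ q.1 → ∃ k', k' ≠ q'.1 ∧ baseDiag q' k' = baseDiag q k) →
      (∀ p ∈ offPositions q.1, ∃ p' ∈ offPositions q'.1, baseOff q' p' = baseOff q p) → G q = G q')
    {ε : ℝ} (hε : 0 < ε) :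
    ∃ N : Network F, ∀ q ∈ S, |N.logit σ q.2 q.1 - G q| < ε := by
  obtain ⟨n, φ, ψ, a, b, hφ, hψ, hclose⟩ :=
    exists_sum_deepSet_close hσ hσ_nonpoly hS hGc hG hε
  obtain ⟨E, hE⟩ := exists_encoder_of_mem_netSpan F hφ hψ (.output (Matrix.of fun i : Fin n =>
    Fin.append (Fin.append (Pi.single i 1) (Pi.single i 1)) 0) 0)
  -- The encoder stays affine after pooling; the equivariant layer, without mixing of alternatives,
  -- supplies the outer activation.
  refine ⟨⟨n, n, E, .single ⟨1, 0, b⟩, a⟩, fun q hq => ?_⟩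
  have := hclose q hq
  simp only [Network.logit, EquivariantStack.eval, EquivariantLayer.eval, hE, MLP.eval]
  simp only [Matrix.mulVec, Matrix.mul_one, Matrix.mul_zero, Matrix.of_apply, add_zero,
    Fin.append_dotProduct_append, single_one_dotProduct, zero_dotProduct, Matrix.zero_apply,
    Finset.sum_const_zero, mul_zero]
  simp only [dotProduct, mul_comm _ (a _)]
  exact this

/-! ### The symmetric square root -/

section ScaleSqrt

open scoped MatrixOrder

variable {K : ℕ} {S : Matrix (Fin K) (Fin K) ℝ}

theorem posSemidef_scaleSqrt (S : Matrix (Fin K) (Fin K) ℝ) : (scaleSqrt S).PosSemidef :=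
  Matrix.nonneg_iff_posSemidef.1 (CFC.sqrt_nonneg S)

theorem scaleSqrt_mul_self (hS : S.PosSemidef) : scaleSqrt S * scaleSqrt S = S :=
  CFC.sqrt_mul_sqrt_self S (Matrix.nonneg_iff_posSemidef.2 hS)

theorem scaleSqrt_unique {A : Matrix (Fin K) (Fin K) ℝ} (hA : A.PosSemidef) (h : A * A = S) :
    scaleSqrt S = A :=
  CFC.sqrt_unique h (Matrix.nonneg_iff_posSemidef.2 hA)

end ScaleSqrt

section Input

variable {K : ℕ} {S : Matrix (Fin K) (Fin K) ℝ}

theorem scaleSqrt_symm (S : Matrix (Fin K) (Fin K) ℝ) (i j : Fin K) :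
    scaleSqrt S i j = scaleSqrt S j i := by
  simpa using (posSemidef_scaleSqrt S).1.apply j i

theorem sum_scaleSqrt_mul (hS : S.PosSemidef) (i j : Fin K) :
    ∑ l, scaleSqrt S i l * scaleSqrt S j l = S i j := by
  conv_rhs => rw [← scaleSqrt_mul_self hS, Matrix.mul_apply]
  exact Finset.sum_congr rfl fun l _ => by rw [scaleSqrt_symm S j l]

theorem scaleSqrt_submatrix (hS : S.PosSemidef) (π : Equiv.Perm (Fin K)) :
    scaleSqrt (S.submatrix π π) = (scaleSqrt S).submatrix π π := by
  refine scaleSqrt_unique ((posSemidef_scaleSqrt S).submatrix π) ?_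
  rw [Matrix.submatrix_mul_equiv, scaleSqrt_mul_self hS]

theorem sum_sq_sub_scaleSqrt (hS : S.PosSemidef) (j k : Fin K) :
    ∑ l, (scaleSqrt S j l - scaleSqrt S k l) ^ 2 = S j j + S k k - 2 * S j k := by
  rw [← sum_scaleSqrt_mul hS j j, ← sum_scaleSqrt_mul hS k k, ← sum_scaleSqrt_mul hS j k,
    Finset.mul_sum, ← Finset.sum_add_distrib, ← Finset.sum_sub_distrib]
  exact Finset.sum_congr rfl fun l _ => by ring

theorem isClosed_posSemidef :
    IsClosed {A : Matrix (Fin K) (Fin K) ℝ | A.PosSemidef} := by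
  simp only [Matrix.posSemidef_iff_dotProduct_mulVec, Set.ofPred_and, Set.ofPred_forall]
  refine IsClosed.inter ?_ (isClosed_iInter fun x => ?_)
  · exact isClosed_eq (by fun_prop) continuous_id
  · exact isClosed_le continuous_const (by fun_prop)

/-- Squaring is a continuous injection on a compact set of positive semidefinite matrices, hence a
closed embedding with continuous inverse. The trace condition bounds the roots: their squared
entries sum to `K`. -/
theorem continuousOn_scaleSqrt :
    ContinuousOn (fun x : ChoiceInput K => scaleSqrt x.2) (inputSpace K) := by
  let T : Set (Matrix (Fin K) (Fin K) ℝ) :=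
    {A | A.PosSemidef} ∩ Set.univ.pi fun _ => Set.univ.pi fun _ => Set.Icc (-(K + 1 : ℝ)) (K + 1)
  have hT : IsCompact T :=
    (isCompact_univ_pi fun _ => isCompact_univ_pi fun _ => isCompact_Icc).inter_left
      isClosed_posSemidef
  have : CompactSpace T := isCompact_iff_compactSpace.1 hT
  have hmem : ∀ x : inputSpace K, scaleSqrt x.1.2 ∈ T := by
    rintro ⟨x, hx⟩
    refine ⟨posSemidef_scaleSqrt _, fun i _ j _ => ?_⟩
    have htr : ∑ i, ∑ l, scaleSqrt x.2 i l * scaleSqrt x.2 i l = K := by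
      rw [← hx.2.2.1]
      exact Finset.sum_congr rfl fun i _ => sum_scaleSqrt_mul hx.2.2.2 i i
    have h1 : scaleSqrt x.2 i j * scaleSqrt x.2 i j ≤ K := by
      rw [← htr]
      refine le_trans ?_ (Finset.single_le_sum
        (f := fun i => ∑ l, scaleSqrt x.2 i l * scaleSqrt x.2 i l)
        (fun i _ => Finset.sum_nonneg fun l _ => mul_self_nonneg _) (Finset.mem_univ i))
      exact Finset.single_le_sum (f := fun l => scaleSqrt x.2 i l * scaleSqrt x.2 i l)
        (fun l _ => mul_self_nonneg _) (Finset.mem_univ j)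
    constructor <;> dsimp only <;> nlinarith
  have hemb : Topology.IsClosedEmbedding fun A : T => A.1 * A.1 := by
    refine Continuous.isClosedEmbedding (by fun_prop) fun A B hAB => ?_
    exact Subtype.ext ((scaleSqrt_unique A.2.1 hAB).symm.trans (scaleSqrt_unique B.2.1 rfl))
  rw [continuousOn_iff_continuous_domRestrict]
  have hc : Continuous fun x : inputSpace K => (⟨_, hmem x⟩ : T) := by
    rw [hemb.isInducing.continuous_iff]
    have : (fun A : T => A.1 * A.1) ∘ (fun x : inputSpace K => (⟨_, hmem x⟩ : T)) =
        fun x => x.1.2 := by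
      ext1 x
      exact scaleSqrt_mul_self x.2.2.2.2
    rw [this]
    fun_prop
  exact continuous_subtype_val.comp hc

/-! ### Choice probabilities -/

open MeasureTheory

theorem volume_hyperplane_eq_zero {c : Fin K → ℝ} (hc : c ≠ 0) (t : ℝ) :
    volume {e : Fin K → ℝ | c ⬝ᵥ e = t} = 0 := by
  let A : AffineSubspace ℝ (Fin K → ℝ) :=
    { carrier := {e | c ⬝ᵥ e = t}
      smul_vsub_vadd_mem' := fun r p₁ p₂ p₃ h₁ h₂ h₃ => by
        simp only [Set.mem_ofPred_eq] at h₁ h₂ h₃ ⊢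
        simp [dotProduct_add, dotProduct_sub, dotProduct_smul, h₁, h₂, h₃] }
  refine Measure.addHaar_affineSubspace volume A fun htop => hc ?_
  have h0 : (0 : Fin K → ℝ) ∈ A := htop ▸ AffineSubspace.mem_top ℝ _ _
  have h1 : c ∈ A := htop ▸ AffineSubspace.mem_top ℝ _ _
  have h0' : c ⬝ᵥ 0 = t := h0
  have h1' : c ⬝ᵥ c = t := h1
  rw [← h0', dotProduct_zero] at h1'
  exact dotProduct_self_eq_zero.1 h1'

/-- The utility of alternative `k`. -/
noncomputable def utility (x : ChoiceInput K) (e : Fin K → ℝ) (k : Fin K) : ℝ :=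
  x.1 k + (scaleSqrt x.2).mulVec e k

theorem mem_choiceRegion {j : Fin K} {x : ChoiceInput K} {e : Fin K → ℝ} :
    e ∈ choiceRegion j x ↔ ∀ k, k ≠ j → utility x e k ≤ utility x e j := Iff.rfl

theorem continuous_utility (x : ChoiceInput K) (k : Fin K) : Continuous fun e => utility x e k := by
  unfold utility Matrix.mulVec dotProduct
  fun_prop

theorem continuousOn_utility (e : Fin K → ℝ) (k : Fin K) :
    ContinuousOn (fun x => utility x e k) (inputSpace K) := by
  unfold utility Matrix.mulVec dotProduct
  refine ContinuousOn.add (by fun_prop) (continuousOn_finsetSum _ fun l _ => ?_)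
  refine ContinuousOn.mul ?_ continuousOn_const
  exact ((continuous_apply l).comp (continuous_apply k)).comp_continuousOn continuousOn_scaleSqrt

theorem measurableSet_choiceRegion (j : Fin K) (x : ChoiceInput K) :
    MeasurableSet (choiceRegion j x) := by
  have : choiceRegion j x = ⋂ k, ⋂ (_ : k ≠ j), {e | utility x e k ≤ utility x e j} := by
    ext e; simp [mem_choiceRegion]
  rw [this]
  exact MeasurableSet.iInter fun k => MeasurableSet.iInter fun _ =>
    (isClosed_le (continuous_utility x k) (continuous_utility x j)).measurableSet

/-- The utility difference is affine in `e`, with linear part the difference of two rows of the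
root. If that is nonzero, ties fill a null hyperplane; if it vanishes, a tie would be certain. -/
theorem ae_utility_ne {x : ChoiceInput K} (hx : x ∈ inputSpace K) {j : Fin K}
    (hj : x ∉ certainTieSet j) : ∀ᵐ e, ∀ k, k ≠ j → utility x e k ≠ utility x e j := by
  refine ae_all_iff.2 fun k => ?_
  by_cases hk : k = j
  · simp [hk]
  have hsub : ∀ e, utility x e j - utility x e k = x.1 j - x.1 k +
      (fun l => scaleSqrt x.2 j l - scaleSqrt x.2 k l) ⬝ᵥ e := by
    intro e
    simp only [utility, Matrix.mulVec, dotProduct, sub_mul, Finset.sum_sub_distrib]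
    ring
  by_cases hc : (fun l => scaleSqrt x.2 j l - scaleSqrt x.2 k l) = 0
  · have h0 : x.2 j j + x.2 k k - 2 * x.2 j k = 0 := by
      rw [← sum_sq_sub_scaleSqrt hx.2.2.2]
      exact Finset.sum_eq_zero fun l _ => by
        have := congrFun hc l
        simp only [Pi.zero_apply] at this
        rw [this]; norm_num
    refine Filter.Eventually.of_forall fun e _ heq => hj ⟨k, hk, ?_, h0⟩
    have := hsub e
    rw [hc, zero_dotProduct, heq] at this
    linarith
  · have := volume_hyperplane_eq_zero hc (x.1 k - x.1 j)
    rw [measure_eq_zero_iff_ae_notMem] at this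
    filter_upwards [this] with e he _ heq
    have := hsub e
    rw [heq] at this
    exact he (by linarith)

variable {f : (Fin K → ℝ) → ℝ}

theorem choiceProb_eq_integral_indicator (f : (Fin K → ℝ) → ℝ) (j : Fin K) (x : ChoiceInput K) :
    choiceProb f j x = ∫ e, (choiceRegion j x).indicator f e :=
  (integral_indicator (measurableSet_choiceRegion j x)).symm

theorem choiceProb_nonneg (hf : IsExchangeableDensity f) (j : Fin K) (x : ChoiceInput K) :
    0 ≤ choiceProb f j x :=
  integral_nonneg hf.nonneg

/-- For almost every `e` the comparisons with `j` at `x` are strict, so they persist nearby and the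
indicator is eventually constant; `‖f e‖` dominates. -/
theorem continuousOn_choiceProb (hf : IsExchangeableDensity f) (j : Fin K) :
    ContinuousOn (choiceProb f j) (inputSpace K \ certainTieSet j) := by
  intro x hx
  have : FirstCountableTopology (Matrix (Fin K) (Fin K) ℝ) :=
    inferInstanceAs (FirstCountableTopology (Fin K → Fin K → ℝ))
  have : choiceProb f j = fun x => ∫ e, (choiceRegion j x).indicator f e :=
    funext fun x => choiceProb_eq_integral_indicator f j x
  rw [this]
  refine continuousWithinAt_of_dominated (bound := fun e => ‖f e‖)
    (Filter.Eventually.of_forall fun y => ?_) (Filter.Eventually.of_forall fun y => ?_)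
    hf.integrable.norm ?_
  · exact (hf.measurable.indicator (measurableSet_choiceRegion j y)).aestronglyMeasurable
  · exact Filter.Eventually.of_forall fun e => norm_indicator_le_norm_self _ _
  filter_upwards [ae_utility_ne hx.1 hx.2] with e he
  have hcu : ∀ k, Filter.Tendsto (fun y => utility y e k)
      (nhdsWithin x (inputSpace K \ certainTieSet j)) (nhds (utility x e k)) :=
    fun k => (continuousOn_utility e k x hx.1).mono_left (nhdsWithin_mono _ Set.sdiff_subset)
  refine Filter.Tendsto.congr' ?_ tendsto_const_nhds
  have hev : ∀ k, ∀ᶠ y in nhdsWithin x (inputSpace K \ certainTieSet j),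
      k ≠ j → (utility y e k ≤ utility y e j ↔ utility x e k ≤ utility x e j) := by
    intro k
    by_cases hk : k = j
    · exact Filter.Eventually.of_forall fun y h => absurd hk h
    rcases lt_or_gt_of_ne (he k hk) with h | h
    · filter_upwards [(hcu k).eventually_lt (hcu j) h] with y hy _
      exact iff_of_true hy.le h.le
    · filter_upwards [(hcu j).eventually_lt (hcu k) h] with y hy _
      exact iff_of_false hy.not_ge h.not_ge
  filter_upwards [Filter.eventually_all.2 hev] with y hy
  have hiff : e ∈ choiceRegion j y ↔ e ∈ choiceRegion j x := by
    simp only [mem_choiceRegion]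
    exact forall_congr' fun k => forall_congr' fun hk => hy k hk
  by_cases hm : e ∈ choiceRegion j x
  · rw [Set.indicator_of_mem hm, Set.indicator_of_mem (hiff.2 hm)]
  · rw [Set.indicator_of_notMem hm, Set.indicator_of_notMem (fun h => hm (hiff.1 h))]

theorem sum_choiceProb (hK : 0 < K) (hf : IsExchangeableDensity f) {x : ChoiceInput K}
    (hx : x ∈ inputSpace K) (hties : ∀ j, x ∉ certainTieSet j) : ∑ j, choiceProb f j x = 1 := by
  have : Nonempty (Fin K) := ⟨⟨0, hK⟩⟩
  simp only [choiceProb_eq_integral_indicator]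
  rw [← integral_finsetSum _ fun j _ => hf.integrable.indicator (measurableSet_choiceRegion j x),
    ← hf.integral_eq_one]
  refine integral_congr_ae ?_
  filter_upwards [ae_all_iff.2 fun j => ae_utility_ne hx (hties j)] with e he
  obtain ⟨j, hj⟩ := Finite.exists_max (utility x e)
  rw [Finset.sum_eq_single j]
  · exact Set.indicator_of_mem (mem_choiceRegion.2 fun k _ => hj k) f
  · intro i _ hi
    refine Set.indicator_of_notMem (fun hm => ?_) f
    exact he j i hi (le_antisymm (hj i) (mem_choiceRegion.1 hm j hi.symm))
  · simp

/-- Relabelling the input amounts to permuting `e`, which preserves both Lebesgue measure and `f`.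
-/
theorem choiceProb_permute (hf : IsExchangeableDensity f) {x : ChoiceInput K}
    (hx : x.2.PosSemidef) (π : Equiv.Perm (Fin K)) (j : Fin K) :
    choiceProb f j (x.1 ∘ π, x.2.submatrix π π) = choiceProb f (π j) x := by
  have hmp := volume_measurePreserving_piCongrLeft (fun _ : Fin K => ℝ) π
  have happ : ∀ e : Fin K → ℝ, MeasurableEquiv.piCongrLeft (fun _ : Fin K => ℝ) π e = e ∘ π.symm := by
    intro e
    ext i
    obtain ⟨i, rfl⟩ := π.surjective i
    simp [MeasurableEquiv.coe_piCongrLeft, Equiv.piCongrLeft_apply_apply]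
  have hU : ∀ e k, utility (x.1 ∘ π, x.2.submatrix π π) e k = utility x (e ∘ π.symm) (π k) := by
    intro e k
    simp only [utility, scaleSqrt_submatrix hx, Matrix.mulVec, dotProduct, Function.comp_apply]
    rw [← Equiv.sum_comp π fun l => scaleSqrt x.2 (π k) l * e (π.symm l)]
    simp
  rw [choiceProb_eq_integral_indicator, choiceProb_eq_integral_indicator,
    ← hmp.integral_comp (MeasurableEquiv.measurableEmbedding _)
      ((choiceRegion (π j) x).indicator f)]
  refine integral_congr_ae (Filter.Eventually.of_forall fun e => ?_)
  simp only [happ]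
  have hiff : e ∈ choiceRegion j (x.1 ∘ π, x.2.submatrix π π) ↔
      e ∘ π.symm ∈ choiceRegion (π j) x := by
    simp only [mem_choiceRegion, hU]
    refine ⟨fun h k hk => ?_, fun h k hk => h (π k) (by simpa using hk)⟩
    have := h (π.symm k) (fun h => hk (by rw [← h]; simp))
    simpa using this
  by_cases hm : e ∘ π.symm ∈ choiceRegion (π j) x
  · rw [Set.indicator_of_mem hm, Set.indicator_of_mem (hiff.2 hm), hf.exchangeable]
  · rw [Set.indicator_of_notMem hm, Set.indicator_of_notMem (fun h => hm (hiff.1 h))]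

end Input

/-! ### The encoder's data determine the input up to a permutation -/

section Identification

variable {K : ℕ}

/-- The above-diagonal position of the unordered pair `{k, l}`. -/
def sortPair (k l : Fin K) : Fin K × Fin K := if k < l then (k, l) else (l, k)

theorem sortPair_comm (k l : Fin K) : sortPair k l = sortPair l k := by
  unfold sortPair
  split_ifs <;> grind

theorem sortPair_injective (k : Fin K) : Function.Injective (sortPair k) := by
  intro l m h
  unfold sortPair at h
  split_ifs at h <;> grind

theorem sortPair_mem_offPositions {j k l : Fin K} (hk : k ≠ j) (hl : l ≠ j) (hkl : k ≠ l) :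
    sortPair k l ∈ offPositions j := by
  simp only [offPositions, sortPair, Finset.mem_filter, Finset.mem_univ, true_and]
  split_ifs <;> grind

/-- The positions of the off-diagonal entries of row `k` that avoid column `j`. -/
def rowPositions (j k : Fin K) : Finset (Fin K × Fin K) :=
  ((Finset.univ.erase j).erase k).image (sortPair k)

theorem rowPositions_subset {j k : Fin K} (hk : k ≠ j) : rowPositions j k ⊆ offPositions j := by
  intro p hp
  obtain ⟨l, hl, rfl⟩ := Finset.mem_image.1 hp
  simp only [Finset.mem_erase, Finset.mem_univ, and_true] at hl
  exact sortPair_mem_offPositions hk hl.2 (Ne.symm hl.1)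

theorem card_rowPositions {j k : Fin K} (hk : k ≠ j) : (rowPositions j k).card = K - 2 := by
  rw [rowPositions, Finset.card_image_of_injective _ (sortPair_injective k),
    Finset.card_erase_of_mem (by simpa using hk), Finset.card_erase_of_mem (Finset.mem_univ j)]
  simp
  omega

theorem apply_sortPair {S : Matrix (Fin K) (Fin K) ℝ} (hS : ∀ i j, S i j = S j i) (k l : Fin K) :
    S (sortPair k l).1 (sortPair k l).2 = S k l := by
  unfold sortPair
  split_ifs
  · rfl
  · exact hS l k

theorem inputSpace_symm {x : ChoiceInput K} (hx : x ∈ inputSpace K) (i j : Fin K) :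
    x.2 i j = x.2 j i := by
  simpa using hx.2.2.2.1.apply j i

/-- Row `k` sums to zero. Hence the row's own positions always solve the subset-sum equation of
`UniqueSumsAt`, and uniqueness singles them out. -/
theorem sum_rowPositions {x : ChoiceInput K} (hx : x ∈ inputSpace K) {j k : Fin K} (hk : k ≠ j) :
    ∑ p ∈ rowPositions j k, x.2 p.1 p.2 = -x.2 k k - x.2 j k := by
  rw [rowPositions, Finset.sum_image fun a _ b _ h => sortPair_injective k h]
  simp only [apply_sortPair (inputSpace_symm hx)]
  have hrow : ∑ l, x.2 k l = 0 := by
    simpa [Matrix.mulVec, dotProduct] using congrFun hx.2.1 k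
  have h1 := Finset.add_sum_erase Finset.univ (x.2 k) (Finset.mem_univ j)
  have h2 := Finset.add_sum_erase (Finset.univ.erase j) (x.2 k) (a := k) (by simpa using hk)
  rw [inputSpace_symm hx j k]
  linarith

theorem rowPositions_mem_powersetCard {j k : Fin K} (hk : k ≠ j) :
    rowPositions j k ∈ (offPositions j).powersetCard (K - 2) :=
  Finset.mem_powersetCard.2 ⟨rowPositions_subset hk, card_rowPositions hk⟩

theorem eq_sortPair_of_mem_rowPositions {j k l : Fin K} {p : Fin K × Fin K} (hkl : k ≠ l)
    (hk : p ∈ rowPositions j k) (hl : p ∈ rowPositions j l) : p = sortPair k l := by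
  obtain ⟨a, -, rfl⟩ := Finset.mem_image.1 hk
  obtain ⟨b, -, hb⟩ := Finset.mem_image.1 hl
  unfold sortPair at hb ⊢
  split_ifs at hb ⊢ <;> grind

/-- One-sided inclusion of the data suffices: distinctness at `q` makes both matchings injective,
and finiteness makes the map on alternatives bijective. Unique sums are needed only at `q'`. -/
theorem exists_perm_of_data_eq (hK : 2 ≤ K) {q q' : Fin K × ChoiceInput K}
    (hq : q.2 ∈ inputSpace K \ exceptionalSet q.1)
    (hq' : q'.2 ∈ inputSpace K \ exceptionalSet q'.1)
    (hdiag : ∀ k, k ≠ q.1 → ∃ k', k' ≠ q'.1 ∧ baseDiag q' k' = baseDiag q k)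
    (hoff : ∀ p ∈ offPositions q.1, ∃ p' ∈ offPositions q'.1, baseOff q' p' = baseOff q p) :
    ∃ π : Equiv.Perm (Fin K), π q.1 = q'.1 ∧ q.2 = (q'.2.1 ∘ π, q'.2.2.submatrix π π) := by
  obtain ⟨j, x⟩ := q
  obtain ⟨j', x'⟩ := q'
  dsimp only at *
  have hx := hq.1
  have hx' := hq'.1
  have hgood : DistinctAt j x ∧ UniqueSumsAt j x := by
    by_contra h; exact hq.2 ⟨hx, h⟩
  have hgood' : DistinctAt j' x' ∧ UniqueSumsAt j' x' := by
    by_contra h; exact hq'.2 ⟨hx', h⟩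
  choose! g hgj hg using hdiag
  choose! τ hτmem hτ using hoff
  have hd : ∀ k, k ≠ j → x'.1 j' = x.1 j ∧ x'.1 (g k) = x.1 k ∧ x'.2 j' j' = x.2 j j ∧
      x'.2 (g k) (g k) = x.2 k k ∧ x'.2 j' (g k) = x.2 j k := by
    intro k hk
    simpa [baseDiag] using hg k hk
  have ho : ∀ p ∈ offPositions j, x'.2 (τ p).1 (τ p).2 = x.2 p.1 p.2 := by
    intro p hp
    simpa [baseOff] using hτ p hp
  let π₀ : Fin K → Fin K := fun k => if k = j then j' else g k
  have hπj : π₀ j = j' := if_pos rfl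
  have hπ : ∀ k, k ≠ j → π₀ k = g k := fun k hk => if_neg hk
  have hinj : Function.Injective π₀ := by
    intro k l hkl
    by_cases hk : k = j <;> by_cases hl : l = j
    · rw [hk, hl]
    · rw [hk, hπj, hπ l hl] at hkl
      exact absurd hkl.symm (hgj l hl)
    · rw [hl, hπj, hπ k hk] at hkl
      exact absurd hkl (hgj k hk)
    · rw [hπ k hk, hπ l hl] at hkl
      refine hgood.1.1 hk hl ?_
      obtain ⟨-, h1, -, h2, h3⟩ := hd k hk
      obtain ⟨-, h1', -, h2', h3'⟩ := hd l hl
      simp only [← h1, ← h2, ← h3, ← h1', ← h2', ← h3', hkl]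
  have hτinj : Set.InjOn τ (offPositions j) := by
    intro p hp p' hp' h
    refine hgood.1.2 hp hp' ?_
    simp only [← ho p hp, ← ho p' hp', h]
  have himage : ∀ k, k ≠ j → (rowPositions j k).image τ = rowPositions j' (g k) := by
    intro k hk
    have hsub : ∀ p ∈ rowPositions j k, p ∈ offPositions j := rowPositions_subset hk
    have hinjk : Set.InjOn τ (rowPositions j k) := hτinj.mono hsub
    -- The transported row has the cardinality and the sum of row `g k`, so it is that row.
    refine (hgood'.2 (g k) (hgj k hk)).unique ⟨?_, ?_⟩
      ⟨rowPositions_mem_powersetCard (hgj k hk), sum_rowPositions hx' (hgj k hk)⟩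
    · refine Finset.mem_powersetCard.2 ⟨fun p' hp' => ?_, ?_⟩
      · obtain ⟨p, hp, rfl⟩ := Finset.mem_image.1 hp'
        exact hτmem p (hsub p hp)
      · rw [Finset.card_image_of_injOn hinjk, card_rowPositions hk]
    · rw [Finset.sum_image hinjk, Finset.sum_congr rfl fun p hp => ho p (hsub p hp),
        sum_rowPositions hx hk, (hd k hk).2.2.2.1, (hd k hk).2.2.2.2]
  have hoffval : ∀ k l, k ≠ j → l ≠ j → k ≠ l → x'.2 (g k) (g l) = x.2 k l := by
    intro k l hk hl hkl
    have hmem : ∀ k l, k ≠ j → l ≠ j → k ≠ l → τ (sortPair k l) ∈ rowPositions j' (g k) := by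
      intro k l hk hl hkl
      rw [← himage k hk]
      exact Finset.mem_image_of_mem _ (Finset.mem_image_of_mem _ (by simp [hl, hkl.symm]))
    have hne : g k ≠ g l := fun h => hkl (hinj (by rw [hπ k hk, hπ l hl, h]))
    have h1 := hmem k l hk hl hkl
    have h2 := hmem l k hl hk hkl.symm
    rw [sortPair_comm] at h2
    -- The matched position lies in both row `g k` and row `g l`, hence is their crossing.
    have h3 := eq_sortPair_of_mem_rowPositions hne h1 h2
    have h4 := ho _ (sortPair_mem_offPositions hk hl hkl)
    rw [h3, apply_sortPair (inputSpace_symm hx'), apply_sortPair (inputSpace_symm hx)] at h4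
    exact h4
  -- The values `v_j` and `Σ_jj` are visible only through some pair `(j, k₀)`.
  obtain ⟨k₀, hk₀⟩ : ∃ k₀ : Fin K, k₀ ≠ j := by
    have : Nontrivial (Fin K) := Fin.nontrivial_iff_two_le.2 hK
    exact exists_ne j
  refine ⟨Equiv.ofBijective π₀ (Finite.injective_iff_bijective.1 hinj), hπj, Prod.ext ?_ ?_⟩
  · funext k
    simp only [Function.comp_apply, Equiv.ofBijective_apply]
    by_cases hk : k = j
    · rw [hk, hπj, (hd k₀ hk₀).1]
    · rw [hπ k hk, (hd k hk).2.1]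
  · ext k l
    simp only [Matrix.submatrix_apply, Equiv.ofBijective_apply]
    by_cases hk : k = j <;> by_cases hl : l = j
    · rw [hk, hl, hπj, (hd k₀ hk₀).2.2.1]
    · rw [hk, hπj, hπ l hl, (hd l hl).2.2.2.2]
    · rw [hl, hπj, hπ k hk, inputSpace_symm hx', inputSpace_symm hx, (hd k hk).2.2.2.2]
    · rw [hπ k hk, hπ l hl]
      by_cases hkl : k = l
      · rw [hkl, (hd l hl).2.2.2.1]
      · exact (hoffval k l hk hl hkl).symm

theorem choiceProb_eq_of_data_eq (hK : 2 ≤ K) {f : (Fin K → ℝ) → ℝ} (hf : IsExchangeableDensity f)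
    {q q' : Fin K × ChoiceInput K}
    (hq : q.2 ∈ inputSpace K \ exceptionalSet q.1)
    (hq' : q'.2 ∈ inputSpace K \ exceptionalSet q'.1)
    (hdiag : ∀ k, k ≠ q.1 → ∃ k', k' ≠ q'.1 ∧ baseDiag q' k' = baseDiag q k)
    (hoff : ∀ p ∈ offPositions q.1, ∃ p' ∈ offPositions q'.1, baseOff q' p' = baseOff q p) :
    choiceProb f q.1 q.2 = choiceProb f q'.1 q'.2 := by
  obtain ⟨π, hπ, hx⟩ := exists_perm_of_data_eq hK hq hq' hdiag hoff
  rw [hx, choiceProb_permute hf hq'.1.2.2.2, hπ]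

/-- Away from all exceptional sets there are no certain ties. -/
theorem notMem_certainTieSet (hK : 2 ≤ K) {x : ChoiceInput K} (hx : x ∈ inputSpace K)
    (hgood : ∀ j, x ∉ exceptionalSet j) (j : Fin K) : x ∉ certainTieSet j := by
  rintro ⟨k, hkj, hv, htie⟩
  have hsq := sum_sq_sub_scaleSqrt hx.2.2.2 j k
  rw [htie, Finset.sum_eq_zero_iff_of_nonneg fun l _ => sq_nonneg _] at hsq
  have hrow : ∀ l, scaleSqrt x.2 j l = scaleSqrt x.2 k l := fun l =>
    sub_eq_zero.1 (pow_eq_zero_iff (two_ne_zero) |>.1 (hsq l (Finset.mem_univ l)))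
  have hS : ∀ l, x.2 j l = x.2 k l := by
    intro l
    rw [← sum_scaleSqrt_mul hx.2.2.2, ← sum_scaleSqrt_mul hx.2.2.2]
    simp only [hrow]
  -- A third alternative `i` would see equal triples for `j` and `k`. With only two alternatives,
  -- equal rows with zero sums force `Σ = 0`, against the trace.
  by_cases hi : ∃ i, i ≠ j ∧ i ≠ k
  · obtain ⟨i, hij, hik⟩ := hi
    have hdist : DistinctAt i x := by
      by_contra h; exact hgood i ⟨hx, fun h' => h h'.1⟩
    refine hkj (hdist.1 (Ne.symm hik) (Ne.symm hij) ?_)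
    simp only [Prod.mk.injEq]
    refine ⟨hv.symm, ?_, ?_⟩
    · rw [← hS k, inputSpace_symm hx, ← hS j]
    · rw [inputSpace_symm hx i k, ← hS i, inputSpace_symm hx]
  · push Not at hi
    have huniv : (Finset.univ : Finset (Fin K)) = {j, k} := by
      ext i
      simp only [Finset.mem_univ, Finset.mem_insert, Finset.mem_singleton, true_iff]
      exact or_iff_not_imp_left.2 (hi i)
    have hsum : ∀ g : Fin K → ℝ, ∑ i, g i = g j + g k := by
      intro g
      rw [huniv, Finset.sum_pair (Ne.symm hkj)]
    have h1 := congrFun hx.2.1 j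
    simp only [Matrix.mulVec, dotProduct, mul_one, hsum, Pi.zero_apply] at h1
    have h2 : x.2 j j + x.2 k k = K := by
      rw [← hx.2.2.1, Matrix.trace, hsum]; rfl
    have h3 := hS j
    have h4 := hS k
    have h5 := inputSpace_symm hx j k
    have hK' : (2 : ℝ) ≤ K := by exact_mod_cast hK
    linarith

end Identification

/-! ### Softmax -/

/-- Numerator and denominator each change by a factor of at most `exp η`; since softmax values are
at most `1`, the relative bound becomes additive. -/
theorem softmax_close {ι : Type*} [Fintype ι] [Nonempty ι] {L G : ι → ℝ} {η : ℝ}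
    (h : ∀ i, |L i - G i| ≤ η) (j : ι) :
    |Real.exp (L j) / ∑ k, Real.exp (L k) - Real.exp (G j) / ∑ k, Real.exp (G k)| ≤
      Real.exp (2 * η) - 1 := by
  have hpos : ∀ M : ι → ℝ, 0 < ∑ k, Real.exp (M k) := fun M =>
    Finset.sum_pos (fun k _ => Real.exp_pos _) Finset.univ_nonempty
  have key : ∀ L G : ι → ℝ, (∀ i, |L i - G i| ≤ η) →
      Real.exp (L j) / ∑ k, Real.exp (L k) ≤
        Real.exp (2 * η) * (Real.exp (G j) / ∑ k, Real.exp (G k)) := by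
    intro L G h
    rw [← mul_div_assoc, div_le_div_iff₀ (hpos L) (hpos G), Finset.mul_sum, Finset.mul_sum]
    refine Finset.sum_le_sum fun k _ => ?_
    rw [← Real.exp_add, ← Real.exp_add, ← Real.exp_add]
    refine Real.exp_le_exp.2 ?_
    have h1 := (abs_le.1 (h j)).2
    have h2 := (abs_le.1 (h k)).1
    linarith
  have hle : ∀ M : ι → ℝ, Real.exp (M j) / ∑ k, Real.exp (M k) ≤ 1 := fun M =>
    div_le_one_of_le₀ (Finset.single_le_sum (f := fun k => Real.exp (M k))
      (fun k _ => (Real.exp_pos _).le) (Finset.mem_univ j)) (hpos M).le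
  have hη : 0 ≤ η := (abs_nonneg _).trans (h j)
  have hexp : 1 ≤ Real.exp (2 * η) := Real.one_le_exp (by linarith)
  have h1 := key L G h
  have h2 := key G L fun i => by rw [abs_sub_comm]; exact h i
  have h3 := hle L
  have h4 := hle G
  rw [abs_le]
  constructor <;> nlinarith

/-! ### The two approximation statements -/

theorem corollary1 {K : ℕ} (hK : 2 ≤ K)
    (f : (Fin K → ℝ) → ℝ) (hf : IsExchangeableDensity f)
    (σ : ℝ → ℝ) (hσ : ContDiff ℝ (⊤ : ℕ∞) σ)
    (hσ_nonpoly : ¬ ∃ p : Polynomial ℝ, ∀ t, σ t = p.eval t)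
    (F : ExtraFeatures K) :
    (∀ (j : Fin K) (C : Set (ChoiceInput K)), IsCompact C →
      C ⊆ inputSpace K \ exceptionalSet j → Disjoint C (certainTieSet j) →
      ∀ ε : ℝ, 0 < ε → ∃ E : Encoder F 1, ∀ x ∈ C, |E.eval σ j x 0 - choiceProb f j x| < ε) ∧
    (∀ C : Set (ChoiceInput K), IsCompact C →
      C ⊆ inputSpace K \ ⋃ j, exceptionalSet j →
      ∀ ε : ℝ, 0 < ε → ∃ N : Network F, ∀ x ∈ C, ∀ j, |N.prob σ x j - choiceProb f j x| < ε) := by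
  refine ⟨fun j C hC hCsub hties ε hε => ?_, fun C hC hCsub ε hε => ?_⟩
  · have hgood : ∀ q ∈ ({j} : Set (Fin K)) ×ˢ C, q.2 ∈ inputSpace K \ exceptionalSet q.1 := by
      rintro ⟨i, x⟩ ⟨rfl, hx⟩
      exact hCsub hx
    obtain ⟨E, hE⟩ := exists_encoder_close hσ hσ_nonpoly F (isCompact_singleton.prod hC)
      (G := fun q => choiceProb f q.1 q.2) (S := {j} ×ˢ C) (by
        have hc : ContinuousOn (fun q : Fin K × ChoiceInput K => choiceProb f j q.2)
            ({j} ×ˢ C) :=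
          (continuousOn_choiceProb hf j).comp continuousOn_snd fun q hq =>
            ⟨(hCsub hq.2).1, Set.disjoint_left.1 hties hq.2⟩
        refine hc.congr ?_
        rintro ⟨i, x⟩ ⟨rfl, hx⟩
        rfl)
      (fun q hq q' hq' => choiceProb_eq_of_data_eq hK hf (hgood q hq) (hgood q' hq')) hε
    exact ⟨E, fun x hx => hE (j, x) ⟨rfl, hx⟩⟩
  · have hgood : ∀ x ∈ C, ∀ j, x ∉ exceptionalSet j := fun x hx j hj =>
      (hCsub hx).2 (Set.mem_iUnion.2 ⟨j, hj⟩)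
    have hties : ∀ x ∈ C, ∀ j, x ∉ certainTieSet j := fun x hx =>
      notMem_certainTieSet hK (hCsub hx).1 (hgood x hx)
    have hK0 : 0 < K := by omega
    have hKpos : (0 : ℝ) < K := by exact_mod_cast hK0
    have : Nonempty (Fin K) := ⟨⟨0, hK0⟩⟩
    -- Probabilities may vanish, so the logits target `log (P_j + δ)`; after normalization by `1 + K
    -- * δ` this costs at most `K * δ`.
    obtain ⟨δ, hδ, hδε⟩ : ∃ δ : ℝ, 0 < δ ∧ K * δ ≤ ε / 2 :=
      ⟨ε / 2 / K, by positivity, by rw [mul_div_cancel₀ _ hKpos.ne']⟩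
    obtain ⟨η, hη, hηε⟩ : ∃ η : ℝ, 0 < η ∧ Real.exp (2 * η) - 1 < ε / 2 := by
      refine ⟨Real.log (1 + ε / 4) / 2, ?_, ?_⟩
      · have := Real.log_pos (show 1 < 1 + ε / 4 by linarith)
        positivity
      · rw [mul_div_cancel₀ _ two_ne_zero, Real.exp_log (by linarith)]
        linarith
    -- Approximating on all pairs `(j, x)` at once gives one set of weights for every alternative.
    obtain ⟨N, hN⟩ := exists_network_logit_close hσ hσ_nonpoly F (isCompact_univ.prod hC)
      (G := fun q => Real.log (choiceProb f q.1 q.2 + δ)) (S := Set.univ ×ˢ C) (by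
        refine continuousOn_prod_of_discrete_left.2 fun j => ?_
        refine ContinuousOn.log (ContinuousOn.add ?_ continuousOn_const) fun x _ =>
          (add_pos_of_nonneg_of_pos (choiceProb_nonneg hf j x) hδ).ne'
        exact (continuousOn_choiceProb hf j).mono fun x hx =>
          ⟨(hCsub hx.2).1, hties x hx.2 j⟩)
      (fun q hq q' hq' h1 h2 => by
        have := choiceProb_eq_of_data_eq hK hf ⟨(hCsub hq.2).1, hgood _ hq.2 _⟩
          ⟨(hCsub hq'.2).1, hgood _ hq'.2 _⟩ h1 h2
        simp only [this]) hη
    refine ⟨N, fun x hx j => ?_⟩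
    have hsoft := softmax_close (L := N.logit σ x)
      (G := fun j => Real.log (choiceProb f j x + δ)) (η := η)
      (fun i => (hN (i, x) ⟨trivial, hx⟩).le) j
    have hP : ∀ i, 0 ≤ choiceProb f i x := fun i => choiceProb_nonneg hf i x
    have hsum := sum_choiceProb hK0 hf (hCsub hx).1 (hties x hx)
    have hexp : ∀ i, Real.exp (Real.log (choiceProb f i x + δ)) = choiceProb f i x + δ :=
      fun i => Real.exp_log (add_pos_of_nonneg_of_pos (hP i) hδ)
    have hsumδ : ∑ i, (choiceProb f i x + δ) = 1 + K * δ := by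
      rw [Finset.sum_add_distrib, hsum]
      simp
    simp only [hexp, hsumδ] at hsoft
    have hle1 : choiceProb f j x ≤ 1 := by
      rw [← hsum]
      exact Finset.single_le_sum (fun i _ => hP i) (Finset.mem_univ j)
    have hKone : (1 : ℝ) ≤ K := by exact_mod_cast hK0
    have hmix : |(choiceProb f j x + δ) / (1 + K * δ) - choiceProb f j x| ≤ K * δ := by
      have hden : (0 : ℝ) < 1 + K * δ := by positivity
      have e : (choiceProb f j x + δ) / (1 + K * δ) - choiceProb f j x =
          δ * (1 - K * choiceProb f j x) / (1 + K * δ) := by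
        field_simp
        ring
      have habs : |1 - K * choiceProb f j x| ≤ K := by
        have := hP j
        rw [abs_le]
        constructor <;> nlinarith
      rw [e, abs_div, abs_mul, abs_of_pos hδ, abs_of_pos hden, div_le_iff₀ hden]
      have : 0 ≤ K * δ * (K * δ) := by positivity
      nlinarith
    calc |N.prob σ x j - choiceProb f j x|
        ≤ |N.prob σ x j - (choiceProb f j x + δ) / (1 + K * δ)| +
          |(choiceProb f j x + δ) / (1 + K * δ) - choiceProb f j x| := abs_sub_le _ _ _
      _ < ε / 2 + ε / 2 := add_lt_add_of_lt_of_le (hsoft.trans_lt hηε) (hmix.trans hδε)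
      _ = ε := add_halves ε
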